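/- Let $R$ be a rng (an associative ring, not necessarily with identity). Left modules over $R$ are abelian groups with a biadditive associative action of $R$; right modules are left modules over $R^{\mathrm{op}}$. Let $\mathscr{E}\subseteq R$ be a set of pairwise orthogonal idempotents such that, as abelian groups, $R=\bigoplus_{e\in\mathscr{E}}eR=\bigoplus_{e\in\mathscr{E}}Re$ (that is, $R$ has enough idempotents). Suppose that $R$ is idempotent noetherian: for every $e\in\mathscr{E}$, $Re$ is a noetherian left $R$-module and $eR$ is a noetherian right $R$-module. Let $R\text{-mod}$ be the (abelian) category of noetherian left $R$-modules $M$ with $M=\bigoplus_{e\in\mathscr{E}}eM$, and let $R^{\mathrm{op}}\text{-mod}$ be the analogous category for $R^{\mathrm{op}}$ and the same set $\mathscr{E}$. For an abelian category $\mathcal{C}$ with enough projective objects and $d\in\mathbb{N}$: - $\mathcal{C}$ is $d$-$\mathcal{IG}$ if $\operatorname{Ext}^j_{\mathcal{C}}(X,P)=0$ for every projective $P$, every $X\in\mathcal{C}$ and all $j>d$, i.e. if every projective object has injective dimension at most $d$. - An object $X$ is Gorenstein projective if $X\cong\operatorname{coker}(P_{i+1}\to P_i)$ for some $i\in\mathbb{Z}$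 and some exact complex $P_\bullet=(\cdots\to P_{1}\to P_{0}\to P_{-1}\to\cdots)$ of projective objects such that $\operatorname{Hom}_{\mathcal{C}}(P_\bullet,Q)$ is exact for every projective object $Q$. - The G-dimension of $X$ is the minimal $n\in\mathbb{N}$ for which there is an exact sequence $0\to G_n\to\cdots\to G_0\to X\to0$ with all $G_i$ Gorenstein projective, or $\infty$ if there is no such $n$. The category $\mathcal{C}$ is naively $d$-Gorenstein if every object has G-dimension at most $d$. Then, for every $d\in\mathbb{N}$, the following are equivalent: 1. $R$ is idempotent $d$-Iwanaga–Gorenstein, i.e. both $R\text{-mod}$ and $R^{\mathrm{op}}\text{-mod}$ are $d$-$\mathcal{IG}$; 2. $R$ is idempotent $d$-Gorenstein, i.e. both $R\text{-mod}$ and $R^{\mathrm{op}}\text{-mod}$ are naively $d$-Gorenstein. -/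

import Mathlib

open CategoryTheory CategoryTheory.Limits MulOpposite

universe u v

noncomputable section

/-! ## Gorenstein homological algebra in an abelian category -/

namespace GorCat

/-- A totally acyclic complex of projective objects: an exact complex `⋯ → P₁ → P₀ → P₋₁ → ⋯` of
projective objects such that `Hom(P, Q)` is exact for every projective object `Q`. -/
structure IsTotallyAcyclic {C : Type u} [Category.{v} C] [Abelian C]
    (P : ChainComplex C ℤ) : Prop where
  projective : ∀ i : ℤ, Projective (P.X i)
  exact : ∀ i : ℤ, P.ExactAt i
  hom_exact : ∀ Q : C, Projective Q → ∀ (i : ℤ) (f : P.X i ⟶ Q), P.d (i + 1) i ≫ f = 0 →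
    ∃ g : P.X (i - 1) ⟶ Q, P.d i (i - 1) ≫ g = f

/-- An object is Gorenstein projective if it is isomorphic to a syzygy object
`Ωⁱ(P) = coker (Pᵢ₊₁ → Pᵢ)` of a totally acyclic complex of projective objects. -/
def IsGorensteinProjective {C : Type u} [Category.{v} C] [Abelian C] (X : C) : Prop :=
  ∃ P : ChainComplex C ℤ, IsTotallyAcyclic P ∧
    ∃ i : ℤ, Nonempty (X ≅ cokernel (P.d (i + 1) i))

/-- `X` has a resolution `0 → Gₙ → ⋯ → G₀ (→ X → 0)` of length at most `n` by Gorenstein projective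
objects: a complex of Gorenstein projective objects, zero in degrees above `n`, exact outside
degree zero, and with homology `X` in degree zero. -/
def HasGorensteinProjectiveResolution {C : Type u} [Category.{v} C] [Abelian C]
    (X : C) (n : ℕ) : Prop :=
  ∃ G : ChainComplex C ℕ, (∀ i, IsGorensteinProjective (G.X i)) ∧ (∀ i, n < i → IsZero (G.X i)) ∧
    (∀ i, 0 < i → G.ExactAt i) ∧ Nonempty (G.homology 0 ≅ X)

/-- The G-dimension of `X`: the minimal length of a resolution of `X` by Gorenstein projective
objects (`⊤` if there is no finite one). -/
def gDim {C : Type u} [Category.{v} C] [Abelian C] (X : C) : ℕ∞ :=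
  ⨅ (n : ℕ) (_ : HasGorensteinProjectiveResolution X n), (n : ℕ∞)

/-- `C` is naively `d`-Gorenstein: every object has G-dimension at most `d`. -/
def IsNaivelyGorenstein (C : Type u) [Category.{v} C] [Abelian C] (d : ℕ) : Prop :=
  ∀ X : C, gDim X ≤ d

/-- `C` is `d`-IG: every projective object has injective dimension at most `d`. -/
def IsIG (C : Type u) [Category.{v} C] [Abelian C] (d : ℕ) : Prop :=
  ∀ P : C, Projective P → HasInjectiveDimensionLE P d

end GorCat

/-! ## Rngs with enough idempotents and their modules -/

namespace Rng

/-- `E` is a set of pairwise orthogonal idempotents of the rng `R` such that, as abelian groups,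
`R` is the internal direct sum of the `eR`, and also of the `Re`, for `e ∈ E`. -/
class EnoughIdempotents (R : Type u) [NonUnitalRing R] (E : Set R) : Prop where
  idem : ∀ e ∈ E, e * e = e
  ortho : ∀ e ∈ E, ∀ f ∈ E, e ≠ f → e * f = 0
  right_internal : open Classical in
    DirectSum.IsInternal fun e : E => (AddMonoidHom.mulLeft (e : R)).range
  left_internal : open Classical in
    DirectSum.IsInternal fun e : E => (AddMonoidHom.mulRight (e : R)).range

/-- The Dorroh extension `ℤ ⊕ R`. A left module over the rng `R` (an abelian group with a biadditive
associative action of `R`) is the same thing as a unital left module over this ring, `R` acting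
through the embedding `Hat.of`; submodules and module homomorphisms are the same in both senses. -/
def Hat (R : Type u) [NonUnitalRing R] : Type u := Unitization ℤ R

instance (R : Type u) [NonUnitalRing R] : Ring (Hat R) := inferInstanceAs (Ring (Unitization ℤ R))

/-- The embedding of `R` in `ℤ ⊕ R`. -/
def Hat.of {R : Type u} [NonUnitalRing R] : R →ₙ+* Hat R where
  toFun r := (Unitization.inr r : Unitization ℤ R)
  map_zero' := Unitization.inr_zero ℤ
  map_add' := Unitization.inr_add ℤ
  map_mul' := Unitization.inr_mul ℤ

/-- The left `R`-module `Re`, inside `ℤ ⊕ R`. -/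
def leftIdeal {R : Type u} [NonUnitalRing R] (e : R) : Submodule (Hat R) (Hat R) where
  carrier := {x | ∃ r : R, x = Hat.of (r * e)}
  zero_mem' := ⟨0, by simp⟩
  add_mem' := by
    rintro _ _ ⟨r, rfl⟩ ⟨s, rfl⟩
    exact ⟨r + s, by rw [add_mul, map_add]⟩
  smul_mem' := by
    rintro (c : Unitization ℤ R) _ ⟨r, rfl⟩
    refine ⟨c.fst • r + c.snd * r, ?_⟩
    have : ∀ (c : Unitization ℤ R) (x : R),
        c * Unitization.inr x = Unitization.inr (c.fst • x + c.snd * x) := by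
      refine fun c x => Unitization.ext ?_ ?_
      · rw [Unitization.fst_mul, Unitization.fst_inr, Unitization.fst_inr, mul_zero]
      · rw [Unitization.snd_mul, Unitization.snd_inr, Unitization.snd_inr, Unitization.fst_inr,
          zero_smul, add_zero]
    refine (this c (r * e)).trans (congrArg _ ?_)
    rw [add_mul, smul_mul_assoc, mul_assoc]

/-- `R`, with the set `E` of idempotents, is an idempotent noetherian rng: it has enough idempotents,
and for every `e ∈ E`, `Re` is a noetherian left module and `eR` is a noetherian right module
(that is, a noetherian left module over `Rᵐᵒᵖ`). -/
class IdempotentNoetherian (R : Type u) [NonUnitalRing R] (E : Set R) : Prop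
    extends EnoughIdempotents R E where
  left_noetherian : ∀ e ∈ E, IsNoetherian (Hat R) (leftIdeal e)
  right_noetherian : ∀ e ∈ E, IsNoetherian (Hat Rᵐᵒᵖ) (leftIdeal (op e))

/-- The subgroup `eM` of a left `R`-module `M`. -/
def corner {R : Type u} [NonUnitalRing R] (M : Type u) [AddCommGroup M] [Module (Hat R) M]
    (e : R) : AddSubgroup M :=
  (smulAddHom (Hat R) M (Hat.of e)).range

/-- The left `R`-modules `M` which are noetherian and are the internal direct sum of the `eM`,
for `e ∈ E`. -/
def isMod (R : Type u) [NonUnitalRing R] (E : Set R) : ObjectProperty (ModuleCat.{u} (Hat R)) :=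
  fun M => IsNoetherian (Hat R) M ∧
    (open Classical in DirectSum.IsInternal fun e : E => corner M (e : R))

/-- The category `R`-mod. -/
abbrev Mod (R : Type u) [NonUnitalRing R] (E : Set R) : Type (u + 1) := (isMod R E).FullSubcategory

/-! ### `R`-mod is abelian, and the opposite rng has enough idempotents -/

/-- The images of orthogonal idempotent endomorphisms of an abelian group always form a direct
sum. -/
theorem isInternal_range_iff {M : Type u} [AddCommGroup M] {ι : Type u} [DecidableEq ι]
    (p : ι → M →+ M) (hp : ∀ i m, p i (p i m) = p i m) (hpq : ∀ i j, i ≠ j → ∀ m, p i (p j m) = 0) :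
    (DirectSum.IsInternal fun i => (p i).range) ↔ ∀ m, ∃ s : Finset ι, m = ∑ i ∈ s, p i m := by
  classical
  have key (x : DirectSum ι fun i => (p i).range) (i : ι) :
      p i (DirectSum.coeAddMonoidHom (fun i => (p i).range) x) = (x i : M) := by
    induction x using DirectSum.induction_on with
    | zero => simp
    | of j y =>
      obtain ⟨_, z, rfl⟩ := y
      rw [DirectSum.coeAddMonoidHom_of]
      by_cases h : i = j
      · subst h
        rw [DirectSum.of_eq_same, hp]
      · rw [DirectSum.of_eq_of_ne _ _ _ h, hpq _ _ h]
        rfl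
    | add x y hx hy => simp [hx, hy]
  constructor
  · intro h m
    obtain ⟨x, rfl⟩ := h.2 m
    refine ⟨DFinsupp.support x, ?_⟩
    simp only [key]
    rw [DirectSum.coeAddMonoidHom_eq_dfinsuppSum]
    rfl
  · intro h
    refine ⟨fun x y hxy => DFinsupp.ext fun i => Subtype.ext ?_, fun m => ?_⟩
    · rw [← key x i, ← key y i, hxy]
    · obtain ⟨s, hs⟩ := h m
      refine ⟨∑ i ∈ s, DirectSum.of (fun i => (p i).range) i ⟨p i m, m, rfl⟩, ?_⟩
      rw [map_sum]
      simp only [DirectSum.coeAddMonoidHom_of]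
      exact hs.symm

theorem isMod_iff {R : Type u} [NonUnitalRing R] (E : Set R) [EnoughIdempotents R E]
    (M : ModuleCat.{u} (Hat R)) :
    isMod R E M ↔ IsNoetherian (Hat R) M ∧
      ∀ m : M, ∃ s : Finset E, m = ∑ e ∈ s, Hat.of (e : R) • m := by
  classical
  refine and_congr_right fun _ =>
    isInternal_range_iff (fun e : E => smulAddHom (Hat R) M (Hat.of (e : R)))
      (fun e m => ?_) (fun e f h m => ?_)
  · simp only [smulAddHom_apply, ← mul_smul, ← map_mul, EnoughIdempotents.idem _ e.2]
  · simp only [smulAddHom_apply, ← mul_smul, ← map_mul,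
      EnoughIdempotents.ortho _ e.2 _ f.2 fun h' => h (Subtype.ext h'), map_zero, zero_smul]

/-- `R`-mod is a Serre subcategory of the category of all left `R`-modules. -/
instance isSerreClass_isMod (R : Type u) [NonUnitalRing R] (E : Set R) [EnoughIdempotents R E] :
    (isMod R E).IsSerreClass where
  exists_zero := ⟨.of _ PUnit.{u + 1}, ModuleCat.isZero_of_subsingleton _,
    (isMod_iff E _).2
      ⟨inferInstanceAs (IsNoetherian (Hat R) PUnit.{u + 1}), fun _ => ⟨∅, rfl⟩⟩⟩
  prop_of_mono {M N} f hf hN := by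
    rw [ModuleCat.mono_iff_injective] at hf
    rw [isMod_iff] at hN ⊢
    have := hN.1
    refine ⟨isNoetherian_of_injective f.hom hf, fun m => ?_⟩
    obtain ⟨s, hs⟩ := hN.2 (f.hom m)
    refine ⟨s, hf ?_⟩
    change f.hom m = f.hom _
    rw [map_sum]
    simpa only [map_smul] using hs
  prop_of_epi {M N} f hf hM := by
    rw [ModuleCat.epi_iff_surjective] at hf
    rw [isMod_iff] at hM ⊢
    have := hM.1
    refine ⟨isNoetherian_of_surjective f.hom (LinearMap.range_eq_top.2 hf), fun n => ?_⟩
    obtain ⟨m, rfl⟩ := hf n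
    obtain ⟨s, hs⟩ := hM.2 m
    refine ⟨s, ?_⟩
    change f.hom m = ∑ e ∈ s, _ • f.hom m
    conv_lhs => rw [hs]
    simp only [map_sum, map_smul]
  prop_X₂_of_shortExact {S} hS h₁ h₃ := by
    classical
    rw [isMod_iff] at h₁ h₃
    have hex := hS.exact.moduleCat_range_eq_ker
    have := h₁.1
    have := h₃.1
    have hN := isNoetherian_of_range_eq_ker S.f.hom S.g.hom hex
    refine (isMod_iff E _).2 ⟨hN, fun m => ?_⟩
    obtain ⟨s, hs⟩ := h₃.2 (S.g.hom m)
    have hm : m - ∑ e ∈ s, Hat.of (e : R) • m ∈ LinearMap.ker S.g.hom := by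
      rw [LinearMap.mem_ker, map_sub, map_sum, sub_eq_zero]
      simpa only [map_smul] using hs
    rw [← hex] at hm
    obtain ⟨n, hn⟩ := hm
    obtain ⟨t, ht⟩ := h₁.2 n
    have h2 : S.f.hom n = ∑ e ∈ t, Hat.of (e : R) • S.f.hom n := by
      conv_lhs => rw [ht]
      simp only [map_sum, map_smul]
    have h3 : m = ∑ e ∈ s, Hat.of (e : R) • m + ∑ e ∈ t, Hat.of (e : R) • S.f.hom n := by
      rw [← h2, hn]; abel
    refine ⟨s ∪ t, ?_⟩
    have h4 (f : E) (hf : f ∈ s ∪ t) (z : S.X₂) :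
        ∑ e ∈ s ∪ t, Hat.of (e : R) • Hat.of (f : R) • z = Hat.of (f : R) • z := by
      rw [Finset.sum_eq_single_of_mem f hf]
      · rw [← mul_smul, ← map_mul, EnoughIdempotents.idem _ f.2]
      · intro e _ hef
        rw [← mul_smul, ← map_mul, EnoughIdempotents.ortho _ e.2 _ f.2
          fun h => hef (Subtype.ext h), map_zero, zero_smul]
    conv_rhs => rw [h3]
    simp only [smul_add, Finset.smul_sum, Finset.sum_add_distrib]
    conv_lhs => rw [h3]
    rw [Finset.sum_comm, Finset.sum_comm (t := t)]
    exact congrArg₂ _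
      (Finset.sum_congr rfl fun f hf => (h4 f (Finset.mem_union_left _ hf) _).symm)
      (Finset.sum_congr rfl fun f hf => (h4 f (Finset.mem_union_right _ hf) _).symm)

instance (R : Type u) [NonUnitalRing R] (E : Set R) [EnoughIdempotents R E] :
    (isMod R E).IsClosedUnderBinaryProducts where
  limitsOfShape_le := by
    rintro X ⟨p⟩
    refine (isMod R E).prop_of_iso ?_ ((isMod R E).prop_biprod
      (p.prop_diag_obj (.mk .left)) (p.prop_diag_obj (.mk .right)))
    exact IsLimit.conePointUniqueUpToIso (BinaryBiproduct.isLimit _ _)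
      ((IsLimit.postcomposeHomEquiv (diagramIsoPair p.diag) _).2 p.isLimit)

instance (R : Type u) [NonUnitalRing R] (E : Set R) [EnoughIdempotents R E] :
    (isMod R E).IsClosedUnderFiniteProducts := .mk'

instance (R : Type u) [NonUnitalRing R] (E : Set R) [EnoughIdempotents R E] :
    Abelian (Mod R E) := inferInstance

/-- The set `E`, viewed in the opposite rng. -/
abbrev opSet {R : Type u} (E : Set R) : Set Rᵐᵒᵖ := unop ⁻¹' E

theorem right_iff {R : Type u} [NonUnitalRing R] {E : Set R} {_ : DecidableEq E}
    (hi : ∀ e ∈ E, e * e = e) (ho : ∀ e ∈ E, ∀ f ∈ E, e ≠ f → e * f = 0) :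
    (DirectSum.IsInternal fun e : E => (AddMonoidHom.mulLeft (e : R)).range) ↔
      ∀ r : R, ∃ s : Finset E, r = ∑ e ∈ s, e * r := by
  refine isInternal_range_iff (fun e : E => AddMonoidHom.mulLeft (e : R))
    (fun e r => ?_) (fun e f h r => ?_)
  · change (e : R) * (e * r) = e * r
    rw [← mul_assoc, hi _ e.2]
  · change (e : R) * (f * r) = 0
    rw [← mul_assoc, ho _ e.2 _ f.2 fun h' => h (Subtype.ext h'), zero_mul]

theorem left_iff {R : Type u} [NonUnitalRing R] {E : Set R} {_ : DecidableEq E}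
    (hi : ∀ e ∈ E, e * e = e) (ho : ∀ e ∈ E, ∀ f ∈ E, e ≠ f → e * f = 0) :
    (DirectSum.IsInternal fun e : E => (AddMonoidHom.mulRight (e : R)).range) ↔
      ∀ r : R, ∃ s : Finset E, r = ∑ e ∈ s, r * e := by
  refine isInternal_range_iff (fun e : E => AddMonoidHom.mulRight (e : R))
    (fun e r => ?_) (fun e f h r => ?_)
  · change r * (e : R) * e = r * e
    rw [mul_assoc, hi _ e.2]
  · change r * (f : R) * e = 0
    rw [mul_assoc, ho _ f.2 _ e.2 fun h' => h (Subtype.ext h'.symm), mul_zero]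

/-- If a rng has enough idempotents, so has its opposite. -/
instance (R : Type u) [NonUnitalRing R] (E : Set R) [h : EnoughIdempotents R E] :
    EnoughIdempotents Rᵐᵒᵖ (opSet E) := by
  classical
  have hi : ∀ e ∈ opSet E, e * e = e := fun e he => unop_injective (h.idem _ he)
  have ho : ∀ e ∈ opSet E, ∀ f ∈ opSet E, e ≠ f → e * f = 0 := fun e he f hf hef =>
    unop_injective (h.ortho _ hf _ he fun h' => hef (unop_injective h'.symm))
  let j : E ↪ opSet E := ⟨fun e => ⟨op (e : R), e.2⟩, fun a b hab =>
    Subtype.ext (op_injective (congrArg Subtype.val hab))⟩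
  refine ⟨hi, ho, (right_iff hi ho).2 fun r => ?_, (left_iff hi ho).2 fun r => ?_⟩
  · obtain ⟨s, hs⟩ := (left_iff h.idem h.ortho).1 h.left_internal (unop r)
    refine ⟨s.map j, unop_injective ?_⟩
    rw [Finset.sum_map, Finset.unop_sum]
    exact hs
  · obtain ⟨s, hs⟩ := (right_iff h.idem h.ortho).1 h.right_internal (unop r)
    refine ⟨s.map j, unop_injective ?_⟩
    rw [Finset.sum_map, Finset.unop_sum]
    exact hs

/-! ### The two conditions -/

/-- `R` is idempotent `d`-Iwanaga–Gorenstein: `R`-mod and `Rᵒᵖ`-mod are `d`-IG. -/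
def IsIdempotentIwanagaGorenstein (R : Type u) [NonUnitalRing R] (E : Set R)
    [IdempotentNoetherian R E] (d : ℕ) : Prop :=
  GorCat.IsIG (Mod R E) d ∧ GorCat.IsIG (Mod Rᵐᵒᵖ (opSet E)) d

/-- `R` is idempotent `d`-Gorenstein: `R`-mod and `Rᵒᵖ`-mod are naively `d`-Gorenstein. -/
def IsIdempotentGorenstein (R : Type u) [NonUnitalRing R] (E : Set R)
    [IdempotentNoetherian R E] (d : ℕ) : Prop :=
  GorCat.IsNaivelyGorenstein (Mod R E) d ∧ GorCat.IsNaivelyGorenstein (Mod Rᵐᵒᵖ (opSet E)) d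

end Rng
end

/-!
The passage from the naive Gorenstein condition to the Iwanaga–Gorenstein condition holds in any
abelian category. A Gorenstein projective object has no higher extensions by projective objects
(`IsGorensteinProjective.extVanishAbove`), so shifting dimensions along a resolution of length at
most `d` by such objects gives `Extʲ(X, Q) = 0` for every object `X`, projective `Q` and `j > d`
(`isIG_of_isNaivelyGorenstein`).

For the converse both categories are needed, and what links them is the duality `P ↦ Hom(P, R)`
between projective left and projective right modules. All of it is expressed by a category `A` with
functors `F : A ⥤ C` and `G : Aᵒᵖ ⥤ D`, each identifying its source with a full subcategory of
projective objects of which every object is a quotient (`IsProjectiveModel`). A complex over `A` has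
exact image in `C` precisely if its differentials are successive weak kernels in `A`, and exact
image in `D` precisely if they are successive weak cokernels. If projective objects have finite
injective dimension, an exact complex of projective objects indexed by `ℤ` is totally acyclic,
because each of its syzygies is an arbitrarily high syzygy. Hence a complex over `A` with exact
image in `D` is `Hom`-exact there, which says that its image in `C` is exact, and therefore totally
acyclic (`IsProjectiveModel.isTotallyAcyclic`).

Let `X` be an object of `C` with no higher extensions by projective objects. A presentation of `X`
by objects of `A` is extended to the left by weak kernels, giving a projective resolution of `X`,
and to the right by weak cokernels. The image in `D` of this complex is exact: on the left because
the extensions of `X` vanish, on the right by construction. So `X` is Gorenstein projective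
(`IsProjectiveModel.isGorensteinProjective`). If projective objects of `C` have injective dimension
at most `d`, this applies to the `d`-th syzygy of any object, which yields a resolution of length
`d`.

For `R`-mod, `A` is the category of modules in `R`-mod that are projective over `ℤ ⊕ R`, and `G` is
the dual module functor. It is fully faithful and has projective values because finitely generated
projective modules have dual bases (`exists_dualBasis`). Every module in `R`-mod is a quotient of a
finite sum of modules `Re`, and every module in `Rᵒᵖ`-mod is a quotient of the dual of such a sum.
-/

noncomputable section

namespace GorCat

open Abelian

/-! ### Vanishing of extensions by projective objects -/

section Ext

variable {C : Type u} [Category.{v} C] [Abelian C] [HasExt.{max u v} C]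

/-- All groups `Extʲ(X, Q)` with `Q` projective and `j > n` vanish. -/
def ExtVanishAbove (X : C) (n : ℕ) : Prop :=
  ∀ Q : C, Projective Q → ∀ j, n < j → ∀ e : Ext.{max u v} X Q j, e = 0

theorem ExtVanishAbove.mono {X : C} {m n : ℕ} (h : ExtVanishAbove X m) (hmn : m ≤ n) :
    ExtVanishAbove X n :=
  fun Q hQ j hj => h Q hQ j (hmn.trans_lt hj)

theorem ExtVanishAbove.of_iso {X Y : C} (i : X ≅ Y) {n : ℕ} (h : ExtVanishAbove X n) :
    ExtVanishAbove Y n := by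
  intro Q hQ j hj e
  have h1 : (Ext.mk₀ i.inv).comp ((Ext.mk₀ i.hom).comp e (zero_add j)) (zero_add j) = e := by
    rw [Ext.mk₀_comp_mk₀_assoc, i.inv_hom_id, Ext.mk₀_id_comp]
  rw [← h1, h Q hQ j hj ((Ext.mk₀ i.hom).comp e (zero_add j)), Ext.comp_zero]

theorem ExtVanishAbove.of_projective (P : C) [Projective P] : ExtVanishAbove P 0 := by
  rintro Q _ (_ | j) hj e
  · exact absurd hj (lt_irrefl _)
  · exact e.eq_zero_of_projective

theorem ext_eq_zero_of_isZero {X Q : C} (hX : IsZero X) {j : ℕ} (e : Ext.{max u v} X Q j) :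
    e = 0 := by
  rw [← e.mk₀_id_comp, hX.eq_zero_of_src (𝟙 X), Ext.mk₀_zero, Ext.zero_comp]

/-- The condition on injective dimensions, read in the first variable of `Ext`: this is the form in
which both implications use it. -/
theorem isIG_iff_extVanishAbove (d : ℕ) : IsIG C d ↔ ∀ X : C, ExtVanishAbove X d := by
  constructor
  · intro h X Q hQ j hj e
    have := h Q hQ
    exact e.eq_zero_of_hasInjectiveDimensionLT (d + 1) hj
  · intro h Q hQ
    exact HasInjectiveDimensionLT.mk.{max u v} fun j hj X e => h X Q hQ j hj e

/-- Dimension shifting in a single degree. For `j = 0` the hypothesis on `S.X₁` is about morphisms,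
which is what allows a resolution to stop at a zero object. -/
theorem ext_succ_eq_zero_of_shortExact {S : ShortComplex C} (hS : S.ShortExact) {Q : C} {j : ℕ}
    (h₂ : ∀ e : Ext.{max u v} S.X₂ Q (j + 1), e = 0) (h₁ : ∀ e : Ext.{max u v} S.X₁ Q j, e = 0)
    (e : Ext.{max u v} S.X₃ Q (j + 1)) : e = 0 := by
  obtain ⟨x, rfl⟩ := Ext.contravariant_sequence_exact₃ hS Q e (h₂ _) (add_comm 1 j)
  rw [h₁ x, Ext.comp_zero]

theorem ExtVanishAbove.X₃_of_shortExact {S : ShortComplex C} (hS : S.ShortExact)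
    {n : ℕ} (h₂ : ExtVanishAbove S.X₂ (n + 1)) (h₁ : ExtVanishAbove S.X₁ n) :
    ExtVanishAbove S.X₃ (n + 1) := by
  rintro Q hQ (_ | j) hj
  · exact absurd hj (Nat.not_lt_zero _)
  · exact ext_succ_eq_zero_of_shortExact hS (h₂ Q hQ _ hj) (h₁ Q hQ _ (Nat.lt_of_succ_lt_succ hj))

theorem ExtVanishAbove.X₁_of_shortExact {S : ShortComplex C} (hS : S.ShortExact)
    {n : ℕ} (h₂ : ExtVanishAbove S.X₂ n) (h₃ : ExtVanishAbove S.X₃ (n + 1)) :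
    ExtVanishAbove S.X₁ n := by
  intro Q hQ j hj e
  obtain ⟨x, rfl⟩ := Ext.contravariant_sequence_exact₁ hS Q e (add_comm 1 j)
    (h₃ Q hQ _ (Nat.succ_lt_succ hj) _)
  rw [h₂ Q hQ j hj x, Ext.comp_zero]

theorem exists_factor_of_ext_one_eq_zero {S : ShortComplex C} (hS : S.ShortExact) {Q : C}
    (h₃ : ∀ e : Ext.{max u v} S.X₃ Q 1, e = 0) (f : S.X₁ ⟶ Q) : ∃ g : S.X₂ ⟶ Q, S.f ≫ g = f := by
  obtain ⟨x, hx⟩ := Ext.contravariant_sequence_exact₁ hS Q (Ext.mk₀ f) (add_zero 1) (h₃ _)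
  obtain ⟨g, rfl⟩ := Ext.homEquiv₀.symm.surjective x
  refine ⟨g, Ext.homEquiv₀.symm.injective ?_⟩
  rw [Ext.homEquiv₀_symm_apply, Ext.homEquiv₀_symm_apply] at *
  rw [← hx, Ext.mk₀_comp_mk₀]

theorem ext_one_eq_zero_of_exists_factor {S : ShortComplex C} (hS : S.ShortExact)
    [Projective S.X₂] {Q : C} (h : ∀ f : S.X₁ ⟶ Q, ∃ g : S.X₂ ⟶ Q, S.f ≫ g = f)
    (e : Ext.{max u v} S.X₃ Q 1) : e = 0 := by
  obtain ⟨x, rfl⟩ := Ext.contravariant_sequence_exact₃ hS Q e (Ext.eq_zero_of_projective _)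
    (add_zero 1)
  obtain ⟨f, rfl⟩ := Ext.homEquiv₀.symm.surjective x
  obtain ⟨g, rfl⟩ := h f
  rw [Ext.homEquiv₀_symm_apply, ← Ext.mk₀_comp_mk₀, hS.extClass_comp_assoc]

end Ext

/-! ### Syzygies of complexes -/

section Complex

variable {C : Type u} [Category.{v} C] [Abelian C] {ι : Type*} {c : ComplexShape ι}

/-- The syzygy sequence `opcycles i → X j → opcycles j` of a complex. -/
abbrev syzygySequence (K : HomologicalComplex C c) (i j : ι) : ShortComplex C :=
  .mk (K.fromOpcycles i j) (K.pOpcycles j) (by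
    rw [← cancel_epi (K.pOpcycles i), K.p_fromOpcycles_assoc, K.d_pOpcycles, comp_zero])

theorem syzygySequence_shortExact (K : HomologicalComplex C c) {i j : ι} (hij : c.Rel i j)
    (h : K.ExactAt i) : (syzygySequence K i j).ShortExact := by
  have hm : Mono (K.fromOpcycles i j) := by
    obtain rfl := c.next_eq' hij
    exact ShortComplex.Exact.mono_fromOpcycles h
  have hk := K.opcyclesIsCokernel i j (c.prev_eq' hij)
  refine ⟨ShortComplex.exact_of_g_is_cokernel _ (CokernelCofork.IsColimit.ofπ' _ _ fun g hg => ?_)⟩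
  obtain ⟨l, hl⟩ := CokernelCofork.IsColimit.desc' hk g (by
    rw [← K.p_fromOpcycles, Category.assoc]
    exact (congrArg _ hg).trans comp_zero)
  exact ⟨l, hl⟩

variable [HasExt.{max u v} C]

/-- Exactness of `Hom(K, Q)` in degree `i` follows from exactness of `K` there, if the next syzygy
has no extensions by `Q`. -/
theorem exists_factor_of_exactAt (K : HomologicalComplex C c) {i j : ι} (hij : c.Rel i j)
    (h : K.ExactAt i) {Q : C} (hQ : ∀ e : Ext.{max u v} (K.opcycles j) Q 1, e = 0)
    (f : K.X i ⟶ Q) (hf : ∀ k, c.Rel k i → K.d k i ≫ f = 0) :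
    ∃ g : K.X j ⟶ Q, K.d i j ≫ g = f := by
  have hf' : K.d (c.prev i) i ≫ f = 0 := by
    by_cases hr : c.Rel (c.prev i) i
    · exact hf _ hr
    · rw [K.shape _ _ hr, zero_comp]
  obtain ⟨g, hg⟩ := exists_factor_of_ext_one_eq_zero (syzygySequence_shortExact K hij h) hQ
    (K.descOpcycles f _ rfl hf')
  refine ⟨g, ?_⟩
  rw [← K.p_fromOpcycles, Category.assoc]
  exact (congrArg _ hg).trans (K.p_descOpcycles _ _ _ _)

/-- If projective objects have finite injective dimension, then every syzygy of an exact complex of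
projective objects is an arbitrarily high syzygy, so it has no extensions by projective objects. -/
theorem extVanishAbove_opcycles_of_isIG {d : ℕ} (hC : IsIG C d) (K : HomologicalComplex C c)
    (hc : ∀ i, ∃ j, c.Rel i j) (hP : ∀ i, Projective (K.X i)) (hK : ∀ i, K.ExactAt i) (i : ι) :
    ExtVanishAbove (K.opcycles i) 0 := by
  -- Descending induction on `n`, starting from the bound `d` valid for all objects.
  suffices h : ∀ k n, n + k = d → ∀ i, ExtVanishAbove (K.opcycles i) n from h d 0 (zero_add d) i
  intro k
  induction k with
  | zero =>
    rintro n rfl i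
    exact (isIG_iff_extVanishAbove n).1 hC _
  | succ k ih =>
    intro n hn i
    obtain ⟨j, hij⟩ := hc i
    exact ExtVanishAbove.X₁_of_shortExact (syzygySequence_shortExact K hij (hK i))
      ((ExtVanishAbove.of_projective _).mono n.zero_le) (ih (n + 1) (by lia) j)

theorem isTotallyAcyclic_of_isIG {d : ℕ} (hC : IsIG C d) (P : ChainComplex C ℤ)
    (hP : ∀ i, Projective (P.X i)) (hex : ∀ i, P.ExactAt i) : IsTotallyAcyclic P where
  projective := hP
  exact := hex
  hom_exact Q hQ i f hf := by
    refine exists_factor_of_exactAt P (by simp) (hex i)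
      (extVanishAbove_opcycles_of_isIG hC P (fun i => ⟨i - 1, by simp⟩) hP hex _ Q hQ 1 one_pos)
      f fun k hk => ?_
    obtain rfl : i + 1 = k := hk
    exact hf

/-- Exactness of `Hom(P, Q)` is the vanishing of `Ext¹` from all syzygies to `Q`; the higher
extension groups vanish by dimension shifting. -/
theorem IsTotallyAcyclic.extVanishAbove_opcycles {P : ChainComplex C ℤ} (hP : IsTotallyAcyclic P)
    (i : ℤ) : ExtVanishAbove (P.opcycles i) 0 := by
  have hse (i : ℤ) := syzygySequence_shortExact P (i := i + 1) (j := i) (by simp) (hP.exact _)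
  have hpr := hP.projective
  intro Q hQ j hj
  obtain ⟨j, rfl⟩ := Nat.exists_eq_add_one_of_ne_zero hj.ne'
  clear hj
  induction j generalizing i with
  | zero =>
    refine ext_one_eq_zero_of_exists_factor (hse i) fun f => ?_
    have key (k : ℤ) (hk : k = i + 1 - 1) :
        ∃ g : P.X k ⟶ Q, P.d (i + 1) k ≫ g = P.pOpcycles (i + 1) ≫ f := by
      subst hk
      exact hP.hom_exact Q hQ (i + 1) _ (by rw [P.d_pOpcycles_assoc, zero_comp])
    obtain ⟨g, hg⟩ := key i (by lia)
    refine ⟨g, ?_⟩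
    rw [← cancel_epi (P.pOpcycles (i + 1)), P.p_fromOpcycles_assoc, hg]
  | succ j ih =>
    exact ext_succ_eq_zero_of_shortExact (hse i) (fun e => e.eq_zero_of_projective) (ih (i + 1))

/-- The object of opcycles in degree `j`, as a cokernel of the incoming differential. -/
def cokernelIsoOpcycles {ι : Type*} {c : ComplexShape ι} (K : HomologicalComplex C c) {i j : ι}
    (hij : c.Rel i j) : cokernel (K.d i j) ≅ K.opcycles j :=
  (cokernelIsCokernel (K.d i j)).coconePointUniqueUpToIso
    (K.opcyclesIsCokernel i j (c.prev_eq' hij))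

theorem IsGorensteinProjective.extVanishAbove {X : C} (hX : IsGorensteinProjective X) :
    ExtVanishAbove X 0 := by
  obtain ⟨P, hP, i, ⟨e⟩⟩ := hX
  exact (hP.extVanishAbove_opcycles i).of_iso (e ≪≫ cokernelIsoOpcycles P (by simp)).symm

theorem HasGorensteinProjectiveResolution.extVanishAbove {X : C} {n : ℕ}
    (hX : HasGorensteinProjectiveResolution X n) : ExtVanishAbove X n := by
  obtain ⟨G, hG, hz, hex, ⟨e⟩⟩ := hX
  refine ExtVanishAbove.of_iso (G.isoHomologyι₀.symm ≪≫ e) ?_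
  -- `opcycles i` has a resolution of length `n - i` by Gorenstein projective objects.
  suffices h : ∀ k i, i + k = n → ExtVanishAbove (G.opcycles i) k from h n 0 (zero_add n)
  have hse (i : ℕ) := syzygySequence_shortExact G (i := i + 1) (j := i) (by simp)
    (hex _ i.succ_pos)
  intro k
  induction k with
  | zero =>
    rintro i rfl
    have h0 : IsZero (G.opcycles (i + 1)) :=
      (hz (i + 1) (by simp)).of_epi (G.pOpcycles (i + 1))
    intro Q hQ j hj
    obtain ⟨j, rfl⟩ := Nat.exists_eq_add_one_of_ne_zero hj.ne'
    exact ext_succ_eq_zero_of_shortExact (hse i) ((hG i).extVanishAbove Q hQ _ hj)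
      (ext_eq_zero_of_isZero h0)
  | succ k ih =>
    intro i hi
    exact ExtVanishAbove.X₃_of_shortExact (hse i) ((hG i).extVanishAbove.mono (Nat.zero_le _))
      (ih (i + 1) (by lia))

theorem isIG_of_isNaivelyGorenstein {d : ℕ} (h : IsNaivelyGorenstein C d) : IsIG C d := by
  refine (isIG_iff_extVanishAbove d).2 fun X => ?_
  have hX : gDim X < (d + 1 : ℕ) := (h X).trans_lt (by exact_mod_cast d.lt_succ_self)
  rw [gDim] at hX
  simp only [iInf_lt_iff] at hX
  obtain ⟨n, hn, hnd⟩ := hX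
  exact hn.extVanishAbove.mono (by exact_mod_cast Nat.lt_succ_iff.1 (by exact_mod_cast hnd))

end Complex

/-! ### Construction of Gorenstein projective resolutions -/

section Resolution

variable {C : Type u} [Category.{v} C] [Abelian C]

open ZeroObject in
theorem IsGorensteinProjective.of_isZero {X : C} (hX : IsZero X) : IsGorensteinProjective X := by
  have h0 (i : ℤ) : IsZero ((0 : ChainComplex C ℤ).X i) := by
    rw [IsZero.iff_id_eq_zero, ← HomologicalComplex.id_f,
      (isZero_zero (ChainComplex C ℤ)).eq_of_src (𝟙 _) 0, HomologicalComplex.zero_f]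
  refine ⟨0, ⟨fun i => (h0 i).projective, fun i => ?_, fun Q _ i f _ => ⟨0, ?_⟩⟩, 0, ⟨?_⟩⟩
  · exact ShortComplex.exact_of_isZero_X₂ _ (h0 i)
  · exact (h0 i).eq_of_src _ _
  · exact hX.iso ((h0 0).of_epi (cokernel.π _))

theorem HasGorensteinProjectiveResolution.zero {X : C} (hX : IsGorensteinProjective X) :
    HasGorensteinProjectiveResolution X 0 := by
  refine ⟨(ChainComplex.single₀ C).obj X, ?_, ?_, ?_, ⟨?_⟩⟩
  · rintro (_ | i)
    · exact hX
    · exact .of_isZero (HomologicalComplex.isZero_single_obj_X _ _ _ _ (by simp))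
  · exact fun i hi => HomologicalComplex.isZero_single_obj_X _ _ _ _ hi.ne'
  · exact fun i hi => HomologicalComplex.exactAt_single_obj _ _ _ _ hi.ne'
  · exact HomologicalComplex.singleObjHomologySelfIso _ _ _

/-- A resolution of `S.X₁` is prolonged by the object `S.X₂` to a resolution of `S.X₃`. -/
theorem HasGorensteinProjectiveResolution.succ {S : ShortComplex C} (hS : S.ShortExact) {n : ℕ}
    (h₁ : HasGorensteinProjectiveResolution S.X₁ n) (h₂ : IsGorensteinProjective S.X₂) :
    HasGorensteinProjectiveResolution S.X₃ (n + 1) := by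
  obtain ⟨G, hG, hz, hex, ⟨e⟩⟩ := h₁
  have := hS.mono_f
  have := hS.epi_g
  let p : G.X 0 ⟶ S.X₁ := G.pOpcycles 0 ≫ G.isoHomologyι₀.inv ≫ e.hom
  have hp : Epi p := inferInstance
  have hdp : G.d 1 0 ≫ p = 0 := by simp [p]
  -- `p` is the cokernel of `d 1 0`, up to the isomorphism of the cokernel with `S.X₁`.
  have hpe : (ShortComplex.mk _ _ hdp).Exact := by
    refine (ShortComplex.exact_iff_of_epi_of_isIso_of_mono (S₁ := .mk _ _ (G.d_pOpcycles 1 0))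
      (S₂ := .mk _ _ hdp) { τ₁ := 𝟙 _, τ₂ := 𝟙 _, τ₃ := G.isoHomologyι₀.inv ≫ e.hom }).1 ?_
    exact ShortComplex.exact_of_g_is_cokernel _ (G.opcyclesIsCokernel 1 0 (by simp))
  refine ⟨G.augment (p ≫ S.f) (by rw [reassoc_of% hdp, zero_comp]), ?_, ?_, ?_, ⟨?_⟩⟩
  · rintro (_ | i)
    exacts [h₂, hG i]
  · rintro (_ | i) hi
    exacts [absurd hi (Nat.not_lt_zero _), hz i (Nat.lt_of_succ_lt_succ hi)]
  · rintro (_ | _ | i) hi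
    · exact absurd hi (lt_irrefl _)
    · rw [HomologicalComplex.exactAt_iff' _ 2 1 0 (by simp) (by simp)]
      exact (ShortComplex.exact_iff_of_epi_of_isIso_of_mono (S₁ := .mk _ _ hdp)
        (S₂ := .mk (G.d 1 0) (p ≫ S.f) (by rw [reassoc_of% hdp, zero_comp]))
        { τ₁ := 𝟙 _, τ₂ := 𝟙 _, τ₃ := S.f }).1 hpe
    · have h := hex (i + 1) i.succ_pos
      rw [HomologicalComplex.exactAt_iff' _ (i + 2) (i + 1) i (by simp) (by simp)] at h
      rw [HomologicalComplex.exactAt_iff' _ (i + 3) (i + 2) (i + 1) (by simp) (by simp)]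
      exact h
  · refine (ChainComplex.isoHomologyι₀ _) ≪≫ (cokernelIsoOpcycles _ (i := 1) (j := 0) (by simp)).symm
      ≪≫ ?_
    refine (cokernelEpiComp p S.f : cokernel (p ≫ S.f) ≅ _) ≪≫ ?_
    exact (cokernelIsCokernel S.f).coconePointUniqueUpToIso hS.gIsCokernel

end Resolution

/-! ### Weak kernels and complexes built from them -/

section Weak

variable {A : Type*} [Category* A] [HasZeroMorphisms A]

/-- `u` is a weak kernel of `f`: the sequence `z → x → y` becomes exact after applying any
`Hom(w, -)`. -/
def IsWeakKernel {x y z : A} (u : z ⟶ x) (f : x ⟶ y) : Prop :=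
  u ≫ f = 0 ∧ ∀ ⦃w : A⦄ (g : w ⟶ x), g ≫ f = 0 → ∃ h : w ⟶ z, h ≫ u = g

/-- `f` is a weak cokernel of `u`: the sequence `z → x → y` becomes exact after applying any
`Hom(-, w)`. -/
def IsWeakCokernel {x y z : A} (u : z ⟶ x) (f : x ⟶ y) : Prop :=
  u ≫ f = 0 ∧ ∀ ⦃w : A⦄ (g : x ⟶ w), u ≫ g = 0 → ∃ h : y ⟶ w, f ≫ h = g

theorem isWeakKernel_op_iff {x y z : A} (u : z ⟶ x) (f : x ⟶ y) :
    IsWeakKernel f.op u.op ↔ IsWeakCokernel u f := by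
  constructor
  · intro h
    refine ⟨Quiver.Hom.op_inj h.1, fun w g hg => ?_⟩
    obtain ⟨k, hk⟩ := h.2 g.op (by rw [← op_comp, hg]; rfl)
    exact ⟨k.unop, Quiver.Hom.op_inj hk⟩
  · intro h
    refine ⟨congrArg Quiver.Hom.op h.1, fun w g hg => ?_⟩
    obtain ⟨k, hk⟩ := h.2 g.unop (Quiver.Hom.op_inj hg)
    exact ⟨k.op, Quiver.Hom.unop_inj hk⟩

variable (A) in
/-- Every morphism has a weak kernel. -/
def HasWeakKernels : Prop :=
  ∀ ⦃x y : A⦄ (f : x ⟶ y), ∃ (z : A) (u : z ⟶ x), IsWeakKernel u f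

/-- Iterating weak kernels extends a morphism to a left infinite sequence. -/
theorem HasWeakKernels.exists_sequence (hA : HasWeakKernels A) {x y : A} (f : x ⟶ y) :
    ∃ (c : ℕ → A) (d₀ : c 0 ⟶ x) (d : ∀ n, c (n + 1) ⟶ c n),
      IsWeakKernel d₀ f ∧ IsWeakKernel (d 0) d₀ ∧ ∀ n, IsWeakKernel (d (n + 1)) (d n) := by
  choose k ι hι using hA
  -- The target of each morphism of `s` is definitionally the source of the preceding one.
  let s : ℕ → Σ x y : A, x ⟶ y := fun n =>
    n.rec ⟨_, _, ι f⟩ fun _ t => ⟨_, _, ι t.2.2⟩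
  exact ⟨fun n => (s n).1, ι f, fun n => ι (s n).2.2, hι f, hι _, fun n => hι _⟩

/-- The object in degree `i` of the sequence obtained by extending a morphism `x₁ → x₀` to the left
by a sequence `l` and to the right by a sequence `r`. -/
def spliceX (l : ℕ → A) (x₁ x₀ : A) (r : ℕ → Aᵒᵖ) : ℤ → A
  | Int.ofNat 0 => x₀
  | Int.ofNat 1 => x₁
  | Int.ofNat (n + 2) => l n
  | Int.negSucc n => (r n).unop

/-- The differentials of the spliced sequence. -/
def spliceD {l : ℕ → A} {x₁ x₀ : A} {r : ℕ → Aᵒᵖ} (l₀ : l 0 ⟶ x₁) (ld : ∀ n, l (n + 1) ⟶ l n)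
    (f : x₁ ⟶ x₀) (r₀ : r 0 ⟶ .op x₀) (rd : ∀ n, r (n + 1) ⟶ r n) :
    ∀ i : ℤ, spliceX l x₁ x₀ r (i + 1) ⟶ spliceX l x₁ x₀ r i
  | Int.ofNat 0 => f
  | Int.ofNat 1 => l₀
  | Int.ofNat (n + 2) => ld n
  | Int.negSucc 0 => r₀.unop
  | Int.negSucc (n + 1) => (rd n).unop

/-- Iterating weak kernels and weak cokernels extends a morphism to a complex indexed by `ℤ`. -/
theorem exists_complex (hA : HasWeakKernels A) (hA' : HasWeakKernels Aᵒᵖ) {x₁ x₀ : A}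
    (f : x₁ ⟶ x₀) :
    ∃ (Z : ChainComplex A ℤ) (e₁ : Z.X 1 ≅ x₁) (e₀ : Z.X 0 ≅ x₀), Z.d 1 0 ≫ e₀.hom = e₁.hom ≫ f ∧
      (∀ i, 0 ≤ i → IsWeakKernel (Z.d (i + 1 + 1) (i + 1)) (Z.d (i + 1) i)) ∧
      ∀ i, i < 0 → IsWeakCokernel (Z.d (i + 1 + 1) (i + 1)) (Z.d (i + 1) i) := by
  obtain ⟨l, l₀, ld, hl₀, hl₁, hl⟩ := hA.exists_sequence f
  obtain ⟨r, r₀, rd, hr₀, hr₁, hr⟩ := hA'.exists_sequence f.op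
  let D := spliceD l₀ ld f r₀ rd
  have h₁ : ∀ i, 0 ≤ i → IsWeakKernel (D (i + 1)) (D i)
    | Int.ofNat 0, _ => hl₀
    | Int.ofNat 1, _ => hl₁
    | Int.ofNat (n + 2), _ => hl n
  have h₂ : ∀ i, i < 0 → IsWeakCokernel (D (i + 1)) (D i)
    | Int.negSucc 0, _ => (isWeakKernel_op_iff _ _).1 hr₀
    | Int.negSucc 1, _ => (isWeakKernel_op_iff _ _).1 hr₁
    | Int.negSucc (n + 2), _ => (isWeakKernel_op_iff _ _).1 (hr n)
  have h₀ (i : ℤ) : D (i + 1) ≫ D i = 0 :=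
    (le_or_gt 0 i).elim (fun hi => (h₁ i hi).1) (fun hi => (h₂ i hi).1)
  have hd (i : ℤ) : (ChainComplex.of _ D h₀).d (i + 1) i = D i := ChainComplex.of_d _ _ _
  refine ⟨ChainComplex.of _ D h₀, Iso.refl _, Iso.refl _, ?_, fun i hi => ?_, fun i hi => ?_⟩
  · exact (Category.comp_id _).trans ((hd 0).trans (Category.id_comp _).symm)
  · rw [hd, hd]
    exact h₁ i hi
  · rw [hd, hd]
    exact h₂ i hi

end Weak

/-! ### Categories modelling the projective objects -/

section Generating

variable {A : Type*} [Category* A] [HasZeroMorphisms A] {C : Type u} [Category.{v} C] [Abelian C]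
  {F : A ⥤ C}

/-- `F` identifies `A` with a full subcategory of `C` consisting of projective objects, of which
every object of `C` is a quotient. -/
structure IsProjectiveModel (F : A ⥤ C) : Prop where
  full : F.Full
  faithful : F.Faithful
  preservesZero : F.PreservesZeroMorphisms
  projective (a : A) : Projective (F.obj a)
  exists_epi (X : C) : ∃ (a : A) (p : F.obj a ⟶ X), Epi p

variable (hF : IsProjectiveModel F)
include hF

/-- Exactness in `C` can be tested by morphisms from the objects `F a`, since they are projective
and every object is a quotient of one of them. -/
theorem IsProjectiveModel.exact_iff {x y z : A} (u : z ⟶ x) (f : x ⟶ y)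
    (w : F.map u ≫ F.map f = 0) :
    (ShortComplex.mk _ _ w).Exact ↔ IsWeakKernel u f := by
  have := hF.full
  have := hF.faithful
  have := hF.preservesZero
  have := hF.projective
  constructor
  · refine fun h => ⟨F.map_injective (by rw [F.map_comp, w, F.map_zero]), fun a g hg => ?_⟩
    have hg' : F.map g ≫ F.map f = 0 := by rw [← F.map_comp, hg, F.map_zero]
    obtain ⟨k, hk⟩ := F.map_surjective (h.liftFromProjective (F.map g) hg')
    refine ⟨k, F.map_injective ?_⟩
    rw [F.map_comp, hk]
    exact h.liftFromProjective_comp _ _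
  · intro h
    rw [ShortComplex.exact_iff_exact_up_to_refinements]
    intro Y g hg
    obtain ⟨a, p, hp⟩ := hF.exists_epi Y
    obtain ⟨g', hg'⟩ := F.map_surjective (p ≫ g)
    obtain ⟨k, hk⟩ := h.2 g' (F.map_injective (by
      rw [F.map_comp, hg', Category.assoc]
      exact (congrArg _ hg).trans (by simp)))
    refine ⟨_, p, hp, F.map k, ?_⟩
    rw [← hg', ← hk, F.map_comp]

/-- Any quotient map from an object `F a` onto the kernel in `C` of `F f` gives a weak kernel of `f`. -/
theorem IsProjectiveModel.hasWeakKernels : HasWeakKernels A := by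
  intro x y f
  have := hF.full
  obtain ⟨a, p, hp⟩ := hF.exists_epi (kernel (F.map f))
  obtain ⟨u, hu⟩ := F.map_surjective (p ≫ kernel.ι (F.map f))
  have w : F.map u ≫ F.map f = 0 := by rw [hu, Category.assoc, kernel.condition, comp_zero]
  refine ⟨a, u, (hF.exact_iff u f w).1 ?_⟩
  refine (ShortComplex.exact_iff_of_epi_of_isIso_of_mono (S₁ := .mk _ _ w)
    (S₂ := .mk _ _ (kernel.condition (F.map f)))
    { τ₁ := p, τ₂ := 𝟙 _, τ₃ := 𝟙 _, comm₁₂ := by simp [hu] }).2 ?_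
  exact ShortComplex.exact_of_f_is_kernel _ (kernelIsKernel _)

theorem IsProjectiveModel.exactAt_iff {ι : Type*} {c : ComplexShape ι}
    [F.PreservesZeroMorphisms] (K : HomologicalComplex A c) {i j k : ι} (hij : c.Rel i j)
    (hjk : c.Rel j k) :
    ((F.mapHomologicalComplex c).obj K).ExactAt j ↔ IsWeakKernel (K.d i j) (K.d j k) := by
  rw [HomologicalComplex.exactAt_iff' _ i j k (c.prev_eq' hij) (c.next_eq' hjk)]
  exact hF.exact_iff _ _ _

end Generating

/-! ### Categories whose projective objects are in duality -/

section Duality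

variable {A : Type*} [Category* A] [HasZeroMorphisms A] {C : Type u} [Category.{v} C] [Abelian C]
  {D : Type u} [Category.{v} D] [Abelian D] {F : A ⥤ C} {G : Aᵒᵖ ⥤ D}
  (hF : IsProjectiveModel F) (hG : IsProjectiveModel G) [HasExt.{max u v} C] [HasExt.{max u v} D]
  {d : ℕ}
include hF hG

/-- A complex over `A` with exact image in `D` has totally acyclic image in `C`: the image in `D`
is `Hom`-exact against projective objects, which by duality is exactness of the image in `C`. -/
theorem IsProjectiveModel.isTotallyAcyclic [F.PreservesZeroMorphisms]
    (hC : IsIG C d) (hD : IsIG D d) (Z : ChainComplex A ℤ)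
    (hZ : ∀ i, IsWeakCokernel (Z.d (i + 1 + 1) (i + 1)) (Z.d (i + 1) i)) :
    IsTotallyAcyclic ((F.mapHomologicalComplex _).obj Z) := by
  have := hG.preservesZero
  have := hG.full
  have := hG.faithful
  let K := (G.mapHomologicalComplex _).obj Z.op
  have hKP (i : ℤ) : Projective (K.X i) := hG.projective _
  -- Weak cokernels in `A` are weak kernels in `Aᵒᵖ`.
  have hK (i : ℤ) : K.ExactAt i := by
    obtain ⟨i, rfl⟩ : ∃ j, i = j + 1 := ⟨i - 1, by lia⟩
    refine (hG.exactAt_iff Z.op (i := i) (k := i + 1 + 1) ?_ ?_).2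
      ((isWeakKernel_op_iff _ _).2 (hZ i)) <;> exact rfl
  refine isTotallyAcyclic_of_isIG hC _ (fun i => hF.projective _) fun i => ?_
  obtain ⟨i, rfl⟩ : ∃ j, i = j + 1 := ⟨i - 1, by lia⟩
  refine (hF.exactAt_iff Z (i := i + 1 + 1) (k := i) (by simp) (by simp)).2
    ⟨Z.d_comp_d _ _ _, fun w g hg => ?_⟩
  obtain ⟨k, hk⟩ := exists_factor_of_exactAt K (i := i + 1) (j := i + 1 + 1) rfl (hK _)
    (extVanishAbove_opcycles_of_isIG hD K (fun i => ⟨i + 1, rfl⟩) hKP hK _ (G.obj (.op w))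
      (hG.projective _) 1 one_pos) (G.map g.op) (by
        rintro j hj
        obtain rfl : j = i := by simpa using hj
        exact (G.map_comp _ _).symm.trans ((congrArg (fun t => G.map t.op) hg).trans (G.map_zero _ _)))
  obtain ⟨k, rfl⟩ := G.map_surjective k
  exact ⟨k.unop, Quiver.Hom.op_inj (G.map_injective ((G.map_comp _ _).trans hk))⟩

/-- A projective presentation of `X` extends to a complex over `A`, to the left by a projective
resolution of `X` and to the right by a resolution, in `D`, of the dual of the presentation. -/
theorem IsProjectiveModel.isGorensteinProjective (hC : IsIG C d) (hD : IsIG D d) {X : C}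
    (hX : ExtVanishAbove X 0) : IsGorensteinProjective X := by
  have := hF.preservesZero
  have := hF.full
  have := hF.faithful
  obtain ⟨x₀, p, hp⟩ := hF.exists_epi X
  obtain ⟨x₁, q, hq⟩ := hF.exists_epi (kernel p)
  obtain ⟨f, hf⟩ := F.map_surjective (q ≫ kernel.ι p)
  obtain ⟨Z, e₁, e₀, he, h₁, h₂⟩ := exists_complex hF.hasWeakKernels hG.hasWeakKernels f
  let K := (F.mapHomologicalComplex _).obj Z
  have eX : cokernel (K.d 1 0) ≅ X :=
    cokernel.mapIso (K.d 1 0) (F.map f) (F.mapIso e₁) (F.mapIso e₀)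
      ((F.map_comp _ _).symm.trans ((congrArg F.map he).trans (F.map_comp _ _))) ≪≫
    cokernelIsoOfEq hf ≪≫ cokernelEpiComp q (kernel.ι p) ≪≫
    (cokernelIsCokernel (kernel.ι p)).coconePointUniqueUpToIso
      (Abelian.epiIsCokernelOfKernel _ (limit.isLimit _))
  have hex (i : ℤ) (hi : 0 ≤ i) : K.ExactAt (i + 1) :=
    (hF.exactAt_iff Z (i := i + 1 + 1) (k := i) (by simp) (by simp)).2 (h₁ i hi)
  have hext (i : ℤ) (hi : 0 ≤ i) : ExtVanishAbove (K.opcycles i) 0 := by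
    induction i, hi using Int.leInduction with
    | base => exact hX.of_iso (eX.symm ≪≫ cokernelIsoOpcycles K (by simp))
    | succ i hi ih =>
      have := hF.projective (Z.X i)
      exact ExtVanishAbove.X₁_of_shortExact
        (syzygySequence_shortExact K (i := i + 1) (j := i) (by simp) (hex i hi))
        (ExtVanishAbove.of_projective (F.obj (Z.X i))) (ih.mono zero_le_one)
  -- In negative degrees `Z` was built from weak cokernels; in the other degrees it is a projective
  -- resolution of `X`, and the syzygies of `X` have no extensions by projective objects.
  refine ⟨K, hF.isTotallyAcyclic hG hC hD Z fun i => ?_, 0, ⟨eX.symm⟩⟩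
  obtain hi | hi := lt_or_ge i 0
  · exact h₂ i hi
  refine ⟨Z.d_comp_d _ _ _, fun w g hg => ?_⟩
  obtain ⟨k, hk⟩ := exists_factor_of_exactAt K (i := i + 1) (j := i) (by simp) (hex i hi)
    (hext i hi _ (hF.projective w) 1 one_pos) (F.map g) (by
      rintro j hj
      obtain rfl : i + 1 + 1 = j := hj
      exact (F.map_comp _ _).symm.trans ((congrArg F.map hg).trans (F.map_zero _ _)))
  obtain ⟨k, rfl⟩ := F.map_surjective k
  exact ⟨k, F.map_injective ((F.map_comp _ _).trans hk)⟩

/-- Iterated syzygies with respect to projective objects: the last one has no extensions by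
projective objects left, so it is Gorenstein projective. -/
theorem IsProjectiveModel.hasGorensteinProjectiveResolution (hC : IsIG C d) (hD : IsIG D d)
    (n : ℕ) (X : C) (hX : ExtVanishAbove X n) : HasGorensteinProjectiveResolution X n := by
  induction n generalizing X with
  | zero => exact .zero (hF.isGorensteinProjective hG hC hD hX)
  | succ n ih =>
    obtain ⟨x, p, hp⟩ := hF.exists_epi X
    have := hF.projective x
    have hS : (ShortComplex.mk _ _ (kernel.condition p)).ShortExact :=
      ⟨ShortComplex.exact_of_f_is_kernel _ (kernelIsKernel p)⟩
    have hx := ExtVanishAbove.of_projective (F.obj x)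
    exact .succ hS (ih _ (ExtVanishAbove.X₁_of_shortExact hS (hx.mono n.zero_le) hX))
      (hF.isGorensteinProjective hG hC hD hx)

theorem IsProjectiveModel.isNaivelyGorenstein (hC : IsIG C d) (hD : IsIG D d) :
    IsNaivelyGorenstein C d := fun X =>
  iInf₂_le_of_le d (hF.hasGorensteinProjectiveResolution hG hC hD d X
    ((isIG_iff_extVanishAbove d).1 hC X)) le_rfl

end Duality

/-- If the projective objects of `C` and `D` are in duality, the two Gorenstein conditions agree.
Only the passage to the naive condition uses the duality. -/
theorem IsProjectiveModel.isIG_and_isIG_iff {A : Type*} [Category* A] [HasZeroMorphisms A]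
    {C : Type u} [Category.{v} C] [Abelian C] {D : Type u} [Category.{v} D] [Abelian D]
    {F : A ⥤ C} {G : Aᵒᵖ ⥤ D} (hF : IsProjectiveModel F) (hG : IsProjectiveModel G) (d : ℕ) :
    IsIG C d ∧ IsIG D d ↔ IsNaivelyGorenstein C d ∧ IsNaivelyGorenstein D d := by
  let := HasExt.standard C
  let := HasExt.standard D
  have hF' : IsProjectiveModel (unopUnop A ⋙ F) := by
    have := hF.full
    have := hF.faithful
    have := hF.preservesZero
    refine ⟨inferInstance, inferInstance, ⟨fun x y => F.map_zero _ _⟩,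
      fun a => hF.projective _, fun X => ?_⟩
    obtain ⟨a, p, hp⟩ := hF.exists_epi X
    exact ⟨.op (.op a), p, hp⟩
  exact ⟨fun h => ⟨hF.isNaivelyGorenstein hG h.1 h.2, hG.isNaivelyGorenstein hF' h.2 h.1⟩,
    fun h => ⟨isIG_of_isNaivelyGorenstein h.1, isIG_of_isNaivelyGorenstein h.2⟩⟩

end GorCat

namespace Rng

/-! ### The opposite of the Dorroh extension -/

section Hat

variable {R : Type u} [NonUnitalRing R]

theorem Hat.mul_of (x : Hat R) (r : R) : ∃ s, x * Hat.of r = Hat.of s := by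
  let c : Unitization ℤ R := x
  refine ⟨c.fst • r + c.snd * r, Unitization.ext ?_ ?_⟩
  · exact (Unitization.fst_mul c (Unitization.inr r)).trans (mul_zero _)
  · refine (Unitization.snd_mul c (Unitization.inr r)).trans ?_
    rw [Unitization.fst_inr, zero_smul, add_zero]
    rfl

theorem Hat.of_mul (r : R) (x : Hat R) : ∃ s, Hat.of r * x = Hat.of s := by
  let c : Unitization ℤ R := x
  refine ⟨c.fst • r + r * c.snd, Unitization.ext ?_ ?_⟩
  · exact (Unitization.fst_mul (Unitization.inr r) c).trans (zero_mul _)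
  · refine (Unitization.snd_mul (Unitization.inr r) c).trans ?_
    rw [Unitization.fst_inr, zero_smul, zero_add]
    rfl

variable (R) in
/-- The Dorroh extension of the opposite rng is the opposite of the Dorroh extension. -/
def hatOp : Hat Rᵐᵒᵖ ≃+* (Hat R)ᵐᵒᵖ :=
  show Unitization ℤ Rᵐᵒᵖ ≃+* (Unitization ℤ R)ᵐᵒᵖ from
  { toFun x := op ⟨x.fst, unop x.snd⟩
    invFun y := ⟨(unop y).fst, op (unop y).snd⟩
    left_inv _ := rfl
    right_inv _ := rfl
    map_add' _ _ := rfl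
    map_mul' x y := by
      refine unop_injective (Unitization.ext (mul_comm x.fst y.fst) ?_)
      exact congrArg (· + unop y.snd * unop x.snd) (add_comm (x.fst • unop y.snd) _) }

theorem hatOp_symm_of (r : R) : (hatOp R).symm (op (Hat.of r)) = Hat.of (op r) := rfl

end Hat

/-! ### Dual modules -/

section Dual

variable (R : Type u) [NonUnitalRing R] (X Y : Type u) [AddCommGroup X] [Module (Hat R) X]
  [AddCommGroup Y] [Module (Hat R) Y]

/-- The dual of a left `R`-module `X`: the module maps from `X` to `ℤ ⊕ R`. If `X` is the direct
sum of the `eX`, all these maps take values in `R`. -/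
def Dual : Type u := X →ₗ[Hat R] Hat R

instance : AddCommGroup (Dual R X) := inferInstanceAs (AddCommGroup (X →ₗ[Hat R] Hat R))

/-- The dual of a left module is a right module, by multiplication of the values on the right. -/
instance : Module (Hat Rᵐᵒᵖ) (Dual R X) :=
  Module.compHom (X →ₗ[Hat R] Hat R) (hatOp R).toRingHom

variable {R X Y}

instance : FunLike (Dual R X) X (Hat R) := inferInstanceAs (FunLike (X →ₗ[Hat R] Hat R) X (Hat R))

instance : LinearMapClass (Dual R X) (Hat R) X (Hat R) :=
  inferInstanceAs (LinearMapClass (X →ₗ[Hat R] Hat R) (Hat R) X (Hat R))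

@[ext]
theorem Dual.ext {φ ψ : Dual R X} (h : ∀ x, φ x = ψ x) : φ = ψ :=
  LinearMap.ext h

@[simp]
theorem Dual.add_apply (φ ψ : Dual R X) (x : X) : (φ + ψ) x = φ x + ψ x := rfl

@[simp]
theorem Dual.smul_apply (a : Hat Rᵐᵒᵖ) (φ : Dual R X) (x : X) :
    (a • φ) x = φ x * unop (hatOp R a) := rfl

@[simp]
theorem Dual.sum_apply {ι : Type*} (s : Finset ι) (φ : ι → Dual R X) (x : X) :
    (∑ i ∈ s, φ i) x = ∑ i ∈ s, φ i x :=
  LinearMap.sum_apply s φ x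

/-- Evaluation of the dual module at `x`, as a map of right modules. -/
def Dual.eval (x : X) : Dual R X →ₗ[Hat Rᵐᵒᵖ] Hat Rᵐᵒᵖ where
  toFun φ := (hatOp R).symm (op (φ x))
  map_add' φ ψ := by rw [Dual.add_apply, MulOpposite.op_add, map_add]
  map_smul' a φ := by
    rw [Dual.smul_apply, op_mul, map_mul, op_unop, RingEquiv.symm_apply_apply]
    rfl

theorem Dual.eval_apply (x : X) (φ : Dual R X) : Dual.eval x φ = (hatOp R).symm (op (φ x)) := rfl

/-- The transpose of a module map. -/
def Dual.map (f : X →ₗ[Hat R] Y) : Dual R Y →ₗ[Hat Rᵐᵒᵖ] Dual R X where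
  toFun φ := LinearMap.comp (show Y →ₗ[Hat R] Hat R from φ) f
  map_add' _ _ := rfl
  map_smul' _ _ := rfl

@[simp]
theorem Dual.map_apply (f : X →ₗ[Hat R] Y) (φ : Dual R Y) (x : X) : Dual.map f φ x = φ (f x) := rfl

/-- A dual basis of `X`: finitely many elements `xᵢ` and forms `φᵢ` such that
`x = ∑ φᵢ(x) xᵢ` for all `x`. -/
theorem exists_dualBasis [Module.Finite (Hat R) X] [Module.Projective (Hat R) X] :
    ∃ (n : ℕ) (b : Fin n → X) (β : Fin n → Dual R X), ∀ x, ∑ i, β i x • b i = x := by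
  obtain ⟨n, f, g, -, -, hfg⟩ := Module.Finite.exists_comp_eq_id_of_projective (Hat R) X
  refine ⟨n, fun i => f (Pi.single i 1), fun i => LinearMap.proj i ∘ₗ g, fun x => ?_⟩
  refine Eq.trans ?_ (LinearMap.congr_fun hfg x)
  change ∑ i, g x i • f (Pi.single i 1) = f (g x)
  simp_rw [← map_smul, ← map_sum]
  congr 1
  ext j
  simp [Pi.single_apply]

theorem Dual.sum_eval_smul {n : ℕ} {b : Fin n → X} {β : Fin n → Dual R X}
    (h : ∀ x, ∑ i, β i x • b i = x) (φ : Dual R X) : ∑ i, Dual.eval (b i) φ • β i = φ := by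
  ext x
  simp only [Dual.sum_apply, Dual.smul_apply, Dual.eval_apply, RingEquiv.apply_symm_apply,
    unop_op]
  conv_rhs => rw [← h x, map_sum]
  simp only [map_smul, smul_eq_mul]

theorem Dual.projective [Module.Finite (Hat R) X] [Module.Projective (Hat R) X] :
    Module.Projective (Hat Rᵐᵒᵖ) (Dual R X) := by
  obtain ⟨n, b, β, h⟩ := exists_dualBasis (R := R) (X := X)
  refine Module.Projective.of_split (M := Fin n → Hat Rᵐᵒᵖ) (LinearMap.pi fun i => Dual.eval (b i))
    (∑ i, (LinearMap.proj i).smulRight (β i)) (LinearMap.ext fun φ => ?_)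
  simpa [LinearMap.sum_apply] using Dual.sum_eval_smul h φ

theorem Dual.map_injective [Module.Finite (Hat R) Y] [Module.Projective (Hat R) Y] :
    Function.Injective (Dual.map : (X →ₗ[Hat R] Y) → _) := by
  intro f g hfg
  obtain ⟨n, b, β, h⟩ := exists_dualBasis (R := R) (X := Y)
  ext x
  rw [← h (f x), ← h (g x)]
  refine Finset.sum_congr rfl fun i _ => congrArg (· • b i) ?_
  exact DFunLike.congr_fun (LinearMap.congr_fun hfg (β i)) x

/-- A right linear `g : Y* → X*` is the transpose of `x ↦ ∑ g(βᵢ)(x) bᵢ`, for a dual basis `(bᵢ, βᵢ)`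
of `Y`. -/
theorem Dual.map_surjective [Module.Finite (Hat R) Y] [Module.Projective (Hat R) Y] :
    Function.Surjective (Dual.map : (X →ₗ[Hat R] Y) → _) := by
  intro g
  obtain ⟨n, b, β, h⟩ := exists_dualBasis (R := R) (X := Y)
  refine ⟨∑ i, (show X →ₗ[Hat R] Hat R from g (β i)).smulRight (b i),
    LinearMap.ext fun ψ => Dual.ext fun x => ?_⟩
  conv_rhs => rw [← Dual.sum_eval_smul h ψ, map_sum, Dual.sum_apply]
  rw [Dual.map_apply, LinearMap.sum_apply, map_sum]
  refine Finset.sum_congr rfl fun i _ => ?_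
  rw [map_smul, Dual.smul_apply, Dual.eval_apply, RingEquiv.apply_symm_apply, unop_op]
  exact map_smul ψ (g (β i) x) (b i)

end Dual

/-! ### Finite sums of the modules `Re` -/

section Generators

variable {R : Type u} [NonUnitalRing R] {E : Set R}

/-- A module in `R`-mod is generated by finitely many elements `xᵢ`, each in some `eᵢX`. -/
theorem exists_finite_generators [EnoughIdempotents R E] {X : ModuleCat.{u} (Hat R)}
    (hX : isMod R E X) :
    ∃ (ι : Type u) (_ : Fintype ι) (e : ι → E) (x : ι → X),
      (∀ i, Hat.of (e i : R) • x i = x i) ∧ Submodule.span (Hat R) (Set.range x) = ⊤ := by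
  obtain ⟨hN, hs⟩ := (isMod_iff E X).1 hX
  obtain ⟨T, hT⟩ := Module.Finite.fg_top (R := Hat R) (M := X)
  choose s hs using hs
  refine ⟨Σ m : T, s m, inferInstance, fun p => p.2, fun p => Hat.of ((p.2 : E) : R) • (p.1 : X),
    fun p => ?_, ?_⟩
  · rw [← mul_smul, ← map_mul, EnoughIdempotents.idem _ (p.2 : E).2]
  · rw [eq_top_iff, ← hT, Submodule.span_le]
    intro m hm
    rw [SetLike.mem_coe, hs m]
    exact sum_mem fun f hf => Submodule.subset_span ⟨⟨⟨m, hm⟩, ⟨f, hf⟩⟩, rfl⟩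

theorem Hat.of_smul_sum_of_subset [EnoughIdempotents R E] {M : Type*} [AddCommGroup M]
    [Module (Hat R) M] {m : M} {s t : Finset E} (hst : s ⊆ t)
    (hs : m = ∑ e ∈ s, Hat.of (e : R) • m) : m = ∑ e ∈ t, Hat.of (e : R) • m := by
  refine hs.trans (Finset.sum_subset hst fun f _ hf => ?_)
  rw [hs, Finset.smul_sum]
  refine Finset.sum_eq_zero fun e he => ?_
  rw [← mul_smul, ← map_mul, EnoughIdempotents.ortho _ f.2 _ e.2, map_zero, zero_smul]
  rintro h
  exact hf (Subtype.ext h ▸ he)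

theorem exists_eq_sum_of_mem_leftIdeal [EnoughIdempotents R E] {e : R} (x : leftIdeal e) :
    ∃ s : Finset E, x = ∑ f ∈ s, Hat.of (f : R) • x := by
  obtain ⟨_, r, rfl⟩ := x
  obtain ⟨s, hs⟩ := (right_iff (E := E) EnoughIdempotents.idem EnoughIdempotents.ortho).1
    EnoughIdempotents.right_internal (r * e)
  refine ⟨s, Subtype.ext ?_⟩
  rw [AddSubmonoidClass.coe_finsetSum]
  exact (congrArg Hat.of hs).trans ((map_sum _ _ _).trans
    (Finset.sum_congr rfl fun f _ => map_mul _ _ _))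

/-- The module `⨁ Reᵢ`, for a finite family of elements `eᵢ`. -/
abbrev PiLeftIdeal {ι : Type u} (e : ι → R) : Type u := ∀ i, leftIdeal (e i)

theorem isMod_piLeftIdeal [EnoughIdempotents R E] {ι : Type u} [Fintype ι] (e : ι → R)
    (he : ∀ i, IsNoetherian (Hat R) (leftIdeal (e i))) :
    isMod R E (.of (Hat R) (PiLeftIdeal e)) := by
  classical
  refine (isMod_iff E _).2 ⟨inferInstanceAs (IsNoetherian (Hat R) (PiLeftIdeal e)), ?_⟩
  intro (m : PiLeftIdeal e)
  choose s hs using fun i => exists_eq_sum_of_mem_leftIdeal (E := E) (m i)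
  refine ⟨Finset.univ.biUnion s, funext fun i => ?_⟩
  refine Eq.trans ?_ (Finset.sum_apply i _ (fun f : E => Hat.of (f : R) • m)).symm
  exact Hat.of_smul_sum_of_subset (Finset.subset_biUnion_of_mem s (Finset.mem_univ i)) (hs i)

/-- The element `e` of `Re`. -/
def leftIdeal.gen {e : R} (he : e * e = e) : leftIdeal e := ⟨Hat.of e, e, by rw [he]⟩

theorem leftIdeal.mul_of {e : R} (he : e * e = e) (x : leftIdeal e) :
    (x : Hat R) * Hat.of e = x := by
  obtain ⟨_, r, rfl⟩ := x
  rw [← map_mul, mul_assoc, he]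

theorem leftIdeal.mul_of_mem {e : R} (he : e * e = e) (x : Hat R) :
    x * Hat.of e ∈ leftIdeal e := by
  obtain ⟨s, hs⟩ := Hat.mul_of x e
  refine ⟨s, ?_⟩
  rw [map_mul, ← hs, mul_assoc, ← map_mul, he]

/-- `Re` is a direct summand of `ℤ ⊕ R`, by right multiplication by `e`. -/
theorem leftIdeal.projective {e : R} (he : e * e = e) : Module.Projective (Hat R) (leftIdeal e) :=
  .of_split (leftIdeal e).subtype
    ((LinearMap.toSpanSingleton (Hat R) (Hat R) (Hat.of e)).codRestrict _
      (leftIdeal.mul_of_mem he))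
    (LinearMap.ext fun x => Subtype.ext (leftIdeal.mul_of he x))

theorem piLeftIdeal_projective {ι : Type u} [Fintype ι] {e : ι → R} (he : ∀ i, e i * e i = e i) :
    Module.Projective (Hat R) (PiLeftIdeal e) :=
  have (i : ι) := leftIdeal.projective (he i)
  .of_equiv (DFinsupp.linearEquivFunOnFintype (R := Hat R) (M := fun i => leftIdeal (e i)))

/-- The map `⨁ Reᵢ → M` determined by elements `xᵢ ∈ eᵢM`. -/
def piLeftIdealDesc {ι : Type u} [Fintype ι] (e : ι → R) {M : Type*} [AddCommGroup M]
    [Module (Hat R) M] (x : ι → M) : PiLeftIdeal e →ₗ[Hat R] M :=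
  ∑ i, ((leftIdeal (e i)).subtype ∘ₗ LinearMap.proj i).smulRight (x i)

theorem piLeftIdealDesc_apply {ι : Type u} [Fintype ι] (e : ι → R) {M : Type*} [AddCommGroup M]
    [Module (Hat R) M] (x : ι → M) (p : PiLeftIdeal e) :
    piLeftIdealDesc e x p = ∑ i, (p i : Hat R) • x i := by
  simp [piLeftIdealDesc, LinearMap.sum_apply]

theorem piLeftIdealDesc_surjective {ι : Type u} [Fintype ι] (e : ι → R) {M : Type*}
    [AddCommGroup M] [Module (Hat R) M] (x : ι → M) (he : ∀ i, e i * e i = e i)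
    (hx : ∀ i, Hat.of (e i) • x i = x i) (hspan : Submodule.span (Hat R) (Set.range x) = ⊤) :
    Function.Surjective (piLeftIdealDesc e x) := by
  classical
  rw [← LinearMap.range_eq_top, eq_top_iff, ← hspan, Submodule.span_le]
  rintro _ ⟨i, rfl⟩
  refine ⟨Pi.single i (leftIdeal.gen (he i)), ?_⟩
  rw [piLeftIdealDesc_apply, Finset.sum_eq_single i]
  · rw [Pi.single_eq_same]
    exact hx i
  · intro j _ hj
    rw [Pi.single_eq_of_ne hj]
    exact zero_smul _ _
  · simp

/-- The map `(⨁ Reᵢ)* → M` determined by elements `xᵢ ∈ Meᵢ` of a right module `M`. -/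
def dualPiLeftIdealDesc {ι : Type u} [Fintype ι] (e : ι → R) (he : ∀ i, e i * e i = e i)
    {M : Type*} [AddCommGroup M] [Module (Hat Rᵐᵒᵖ) M] (x : ι → M) :
    Dual R (PiLeftIdeal e) →ₗ[Hat Rᵐᵒᵖ] M :=
  open Classical in
  ∑ i, (Dual.eval (Pi.single i (leftIdeal.gen (he i)))).smulRight (x i)

theorem dualPiLeftIdealDesc_surjective {ι : Type u} [Fintype ι] (e : ι → R)
    (he : ∀ i, e i * e i = e i) {M : Type*} [AddCommGroup M] [Module (Hat Rᵐᵒᵖ) M] (x : ι → M)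
    (hx : ∀ i, Hat.of (op (e i)) • x i = x i)
    (hspan : Submodule.span (Hat Rᵐᵒᵖ) (Set.range x) = ⊤) :
    Function.Surjective (dualPiLeftIdealDesc e he x) := by
  classical
  rw [← LinearMap.range_eq_top, eq_top_iff, ← hspan, Submodule.span_le]
  rintro _ ⟨i, rfl⟩
  -- The `i`-th projection takes the value `eᵢ` at the `i`-th generator and `0` at the others.
  let π : Dual R (PiLeftIdeal e) := (leftIdeal (e i)).subtype ∘ₗ LinearMap.proj i
  have hπ (p : PiLeftIdeal e) : π p = p i := rfl
  refine ⟨π, ?_⟩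
  rw [dualPiLeftIdealDesc, LinearMap.sum_apply, Finset.sum_eq_single i]
  · rw [LinearMap.smulRight_apply, Dual.eval_apply, hπ, Pi.single_eq_same]
    exact hx i
  · intro j _ hj
    rw [LinearMap.smulRight_apply, Dual.eval_apply, hπ, Pi.single_eq_of_ne hj.symm]
    exact (congrArg (· • x j) (map_zero (hatOp R).symm)).trans (zero_smul _ _)
  · simp

/-- The dual of a module generated by elements `xᵢ ∈ eᵢX` embeds in the finite sum of the `eᵢR`. -/
theorem isMod_dual [h : IdempotentNoetherian R E] {X : ModuleCat.{u} (Hat R)}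
    (hX : isMod R E X) : isMod Rᵐᵒᵖ (opSet E) (.of _ (Dual R X)) := by
  obtain ⟨ι, _, e, x, hx, hspan⟩ := exists_finite_generators hX
  -- As `xᵢ = eᵢxᵢ`, the value `φ(xᵢ) = eᵢφ(xᵢ)` lies in `eᵢR`.
  have hmem (i : ι) (φ : Dual R X) : Dual.eval (x i) φ ∈ leftIdeal (op (e i : R)) := by
    obtain ⟨s, hs⟩ := Hat.of_mul (e i : R) (φ (x i))
    refine ⟨op s, ?_⟩
    rw [Dual.eval_apply, ← hx i, map_smul, smul_eq_mul, ← op_mul, ← hatOp_symm_of, map_mul, ← hs,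
      ← mul_assoc, ← map_mul, EnoughIdempotents.idem _ (e i).2]
  let f : Dual R X →ₗ[Hat Rᵐᵒᵖ] PiLeftIdeal fun i => op (e i : R) :=
    LinearMap.pi fun i => (Dual.eval (x i)).codRestrict _ (hmem i)
  have hf : Function.Injective f := by
    intro φ ψ hφ
    refine LinearMap.ext_on_range hspan fun i => ?_
    have := congrArg Subtype.val (congrFun hφ i)
    exact op_injective ((hatOp R).symm.injective this)
  have := (ModuleCat.mono_iff_injective (ModuleCat.ofHom f)).2 hf
  exact (isMod Rᵐᵒᵖ (opSet E)).prop_of_mono (ModuleCat.ofHom f)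
    (isMod_piLeftIdeal _ fun i => h.right_noetherian _ (e i).2)

end Generators

/-! ### The duality between projective left and right modules -/

section Categories

variable {R : Type u} [NonUnitalRing R] {E : Set R}

theorem Mod.epi_of_surjective [EnoughIdempotents R E] {X Y : Mod R E} (f : X ⟶ Y)
    (hf : Function.Surjective f.hom) : Epi f :=
  have : Epi ((isMod R E).ι.map f) := (ModuleCat.epi_iff_surjective _).2 hf
  (isMod R E).ι.epi_of_epi_map this

/-- The quotient of `Y` by the image of `f` lies in `R`-mod again. -/
theorem Mod.surjective_of_epi [EnoughIdempotents R E] {X Y : Mod R E} (f : X ⟶ Y) [Epi f] :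
    Function.Surjective f.hom := by
  let q : Y.obj ⟶ .of (Hat R) (Y.obj ⧸ LinearMap.range f.hom.hom) :=
    ModuleCat.ofHom (Submodule.mkQ _)
  have : Epi q := (ModuleCat.epi_iff_surjective _).2 (Submodule.mkQ_surjective _)
  let Q : Mod R E := ⟨_, (isMod R E).prop_of_epi q Y.property⟩
  let q' : Y ⟶ Q := ObjectProperty.homMk q
  have h : q' = 0 := by
    rw [← cancel_epi f, comp_zero]
    ext x
    exact (Submodule.Quotient.mk_eq_zero _).2 ⟨x, rfl⟩
  intro y
  exact (Submodule.Quotient.mk_eq_zero _).1 (congrArg (fun t : Y ⟶ Q => t.hom y) h)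

theorem Mod.projective_of_projective [EnoughIdempotents R E] (X : Mod R E)
    (hX : Module.Projective (Hat R) X.obj) : Projective X where
  factors {Y Z} f g _ := by
    obtain ⟨k, hk⟩ := Module.projective_lifting_property g.hom.hom f.hom.hom
      (Mod.surjective_of_epi g)
    exact ⟨ObjectProperty.homMk (ModuleCat.ofHom k), by ext x; exact LinearMap.congr_fun hk x⟩

variable (R E) in
/-- The objects of `R`-mod which are projective modules over `ℤ ⊕ R`. -/
def isProj : ObjectProperty (Mod R E) := fun X => Module.Projective (Hat R) X.obj

/-- Every module in `R`-mod is a quotient of a finite sum of modules `Re`. -/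
theorem exists_projective_cover [h : IdempotentNoetherian R E] (X : Mod R E) :
    ∃ (P : (isProj R E).FullSubcategory) (p : P.obj ⟶ X), Epi p := by
  obtain ⟨ι, _, e, x, hx, hspan⟩ := exists_finite_generators X.property
  have he (i : ι) : (e i : R) * e i = e i := EnoughIdempotents.idem _ (e i).2
  refine ⟨⟨⟨.of _ (PiLeftIdeal fun i => (e i : R)), isMod_piLeftIdeal _ fun i =>
    h.left_noetherian _ (e i).2⟩, piLeftIdeal_projective he⟩,
    ObjectProperty.homMk (ModuleCat.ofHom (piLeftIdealDesc _ x)), Mod.epi_of_surjective _ ?_⟩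
  exact piLeftIdealDesc_surjective _ x he hx hspan

variable (R E) in
theorem isProjectiveModel_ι [IdempotentNoetherian R E] :
    GorCat.IsProjectiveModel (isProj R E).ι where
  full := inferInstance
  faithful := inferInstance
  preservesZero := inferInstance
  projective P := Mod.projective_of_projective _ P.property
  exists_epi X := exists_projective_cover X

variable (R E) in
/-- The duality `P ↦ P*` from projective left modules to right modules. -/
def dualFunctor [IdempotentNoetherian R E] :
    (isProj R E).FullSubcategoryᵒᵖ ⥤ Mod Rᵐᵒᵖ (opSet E) where
  obj P := ⟨.of _ (Dual R P.unop.obj.obj), isMod_dual P.unop.obj.property⟩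
  map f := ObjectProperty.homMk (ModuleCat.ofHom (Dual.map f.unop.hom.hom.hom))

theorem finite_and_projective [EnoughIdempotents R E] (P : (isProj R E).FullSubcategory) :
    Module.Finite (Hat R) P.obj.obj ∧ Module.Projective (Hat R) P.obj.obj :=
  have : IsNoetherian (Hat R) P.obj.obj := P.obj.property.1
  ⟨inferInstance, P.property⟩

variable (R E) in
theorem isProjectiveModel_dualFunctor [h : IdempotentNoetherian R E] :
    GorCat.IsProjectiveModel (dualFunctor R E) where
  full := ⟨fun {P Q} g => by
    obtain ⟨_, _⟩ := finite_and_projective P.unop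
    obtain ⟨f, hf⟩ := Dual.map_surjective (X := Q.unop.obj.obj) (Y := P.unop.obj.obj) g.hom.hom
    refine ⟨(ObjectProperty.homMk (ObjectProperty.homMk (ModuleCat.ofHom f)) :
      Q.unop ⟶ P.unop).op, ?_⟩
    ext φ
    exact LinearMap.congr_fun hf φ⟩
  faithful := ⟨fun {P Q} f g hfg => by
    obtain ⟨_, _⟩ := finite_and_projective P.unop
    have : f.unop.hom.hom.hom = g.unop.hom.hom.hom := Dual.map_injective
      (congrArg (fun t => t.hom.hom) hfg)
    apply Quiver.Hom.unop_inj
    ext x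
    exact LinearMap.congr_fun this x⟩
  preservesZero := ⟨fun P Q => by
    ext φ
    exact Dual.ext fun x => map_zero (show Dual R P.unop.obj.obj from φ)⟩
  projective P := by
    obtain ⟨_, _⟩ := finite_and_projective P.unop
    exact Mod.projective_of_projective _ Dual.projective
  exists_epi Y := by
    obtain ⟨ι, _, e, x, hx, hspan⟩ := exists_finite_generators Y.property
    have he (i : ι) : unop (e i : Rᵐᵒᵖ) * unop (e i : Rᵐᵒᵖ) = unop (e i : Rᵐᵒᵖ) :=
      h.idem _ (e i).2
    refine ⟨.op ⟨⟨.of _ (PiLeftIdeal fun i => unop (e i : Rᵐᵒᵖ)), isMod_piLeftIdeal _ fun i =>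
      h.left_noetherian _ (e i).2⟩, piLeftIdeal_projective he⟩,
      ObjectProperty.homMk (ModuleCat.ofHom (dualPiLeftIdealDesc _ he x)),
      Mod.epi_of_surjective _ ?_⟩
    exact dualPiLeftIdealDesc_surjective _ he x hx hspan

end Categories

end Rng

end

theorem mainTheorem3 (R : Type u) [NonUnitalRing R] (E : Set R) [Rng.IdempotentNoetherian R E]
    (d : ℕ) :
    Rng.IsIdempotentIwanagaGorenstein R E d ↔ Rng.IsIdempotentGorenstein R E d :=
  (Rng.isProjectiveModel_ι R E).isIG_and_isIG_iff (Rng.isProjectiveModel_dualFunctor R E) d
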